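/- Call a line $t$ in the Euclidean plane $\mathbb{R}^2$ together with one of its two directions a directed line; a line with its two opposite directions counts as two different directed lines. A directed line $t$ is a supporting line of a set $H\subseteq\mathbb{R}^2$ if $t\cap H\neq\emptyset$ and $H$ is contained in the closed halfplane on the left of $t$. Say that $K,K'\subseteq\mathbb{R}^2$ cross each other if, for $(X,Y)=(K,K')$ or for $(X,Y)=(K',K)$, there are two different directed lines $t_1\neq t_2$, each of them a supporting line of both $K$ and $K'$, such that for each $i\in\{1,2\}$ the first point of $(K\cup K')\cap t_i$ (with respect to the direction of $t_i$) lies in $X\setminus Y$, while the last point of $(K\cup K')\cap t_i$ lies in $Y\setminus X$. Disks are the convex hulls of circles, where circles of radius $0$ are allowed, so that singletons are disks. Lemma 4. Let $K_0$ be a nonempty compact convex subset of the plane $\mathbb{R}^2$. Then $K_0$ is a disk if and only if for every $K_1\subseteq\mathbb{R}^2$ that is isometric to $K_0$ (that is, $K_1=\varphi(K_0)$ for some isometry $\varphi$ of the plane), the sets $K_0$ and $K_1$ do not cross each other. -/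

import Mathlib

namespace PlaneCrossing

/-- The real plane, with its Euclidean metric. -/
abbrev Plane : Type := EuclideanSpace ℝ (Fin 2)

/-- The determinant of the pair `u, x`. For a unit vector `u` it is the signed distance of `x` from
the line through the origin with direction `u`, positive on the left-hand side of that line. -/
def det (u x : Plane) : ℝ := u 0 * x 1 - u 1 * x 0

/-- A directed line of the plane. It is given by its direction (a unit vector) and by the number
`offset`, the common value of `det dir x` at its points `x`. Every directed line arises from
exactly one such pair; in particular a line taken with its two opposite directions
gives two different directed lines. -/
@[ext] structure DirectedLine where
  dir : Plane
  norm_dir : ‖dir‖ = 1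
  offset : ℝ

/-- The set of the points of a directed line. -/
def DirectedLine.points (l : DirectedLine) : Set Plane := {x | det l.dir x = l.offset}

/-- The closed halfplane on the left of a directed line. -/
def DirectedLine.leftHalfplane (l : DirectedLine) : Set Plane := {x | l.offset ≤ det l.dir x}

/-- `l` is a supporting line of `H`, directed so that `H` is on its left. -/
def IsSupportingLine (H : Set Plane) (l : DirectedLine) : Prop :=
  (l.points ∩ H).Nonempty ∧ H ⊆ l.leftHalfplane

/-- `P` is the first point of `S ∩ l` with respect to the direction of `l`. -/
def IsFirstPoint (S : Set Plane) (l : DirectedLine) (P : Plane) : Prop :=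
  P ∈ S ∩ l.points ∧ ∀ Q ∈ S ∩ l.points, inner ℝ l.dir P ≤ inner ℝ l.dir Q

/-- `P` is the last point of `S ∩ l` with respect to the direction of `l`. -/
def IsLastPoint (S : Set Plane) (l : DirectedLine) (P : Plane) : Prop :=
  P ∈ S ∩ l.points ∧ ∀ Q ∈ S ∩ l.points, inner ℝ l.dir Q ≤ inner ℝ l.dir P

/-- `t` is a common supporting line of `K` and `K'` such that the first point of `(K ∪ K') ∩ t` is
in `K \ K'` and the last point of `(K ∪ K') ∩ t` is in `K' \ K`. -/
def LeadsFromTo (K K' : Set Plane) (t : DirectedLine) : Prop :=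
  IsSupportingLine K t ∧ IsSupportingLine K' t ∧
    (∃ U, IsFirstPoint (K ∪ K') t U ∧ U ∈ K \ K') ∧
    (∃ U', IsLastPoint (K ∪ K') t U' ∧ U' ∈ K' \ K)

/-- `K` and `K'` cross each other: two different common supporting lines both lead from `K` to `K'`,
or two different common supporting lines both lead from `K'` to `K`. -/
def CrossEachOther (K K' : Set Plane) : Prop :=
  (∃ t₁ t₂ : DirectedLine, t₁ ≠ t₂ ∧ LeadsFromTo K K' t₁ ∧ LeadsFromTo K K' t₂) ∨
  (∃ t₁ t₂ : DirectedLine, t₁ ≠ t₂ ∧ LeadsFromTo K' K t₁ ∧ LeadsFromTo K' K t₂)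

/-- `Y` is isometric (congruent) to `X`: it is the image of `X` under an isometry of the plane. -/
def IsIsometricTo (Y X : Set Plane) : Prop := ∃ φ : Plane ≃ᵢ Plane, Y = φ '' X

/-- Circles; radius `0` is allowed, so that singletons are circles. -/
def IsCircle (C : Set Plane) : Prop := ∃ (c : Plane) (r : ℝ), 0 ≤ r ∧ C = Metric.sphere c r

/-- Disks are the convex hulls of circles; singletons are disks. -/
def IsDisk (D : Set Plane) : Prop := ∃ C : Set Plane, IsCircle C ∧ D = convexHull ℝ C

end PlaneCrossing

open MeasureTheory Set Filter Topology

namespace PlaneCrossing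

/-! ### Transversal zeros of Lipschitz functions -/

/-! Common supporting lines are the zeros of the difference of two support functions. Where both
functions are differentiable, their derivatives locate the contact points, so a zero of `suppFun K'
- suppFun K` with negative derivative is a line leading from `K` to `K'` (`leadsFromTo_suppLine`).
Two such zeros within one period give a crossing.

If `K` is not a disk, its support function minus the first harmonic is not constant, so it differs
from some shift of itself. This difference is orthogonal to 1, cos and sin, hence alternates in sign
at four points of a period (`exists_four_sign_changes`); it comes from rotating `K` about a suitable
point. Its zeros may be degenerate or lie where differentiability fails. A small translation adds `t
* sin (θ - p)`, and a Sard-type argument (`ae_forall_zero_transversal`) makes all zeros transversal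
for almost every `t`, while the four signs persist. Convexity serves only to recover a disk from its
support function.

Conversely, a copy of a disk has the same radius, so a line leading from one to the other must point
along the vector between the centres, and is therefore unique. -/

theorem volume_image_eq_zero_of_lipschitzOnWith {f : ℝ → ℝ} {s : Set ℝ} {C : NNReal}
    (hf : LipschitzOnWith C f s) (hs : volume s = 0) : volume (f '' s) = 0 := by
  have h := hf.hausdorffMeasure_image_le (d := 1) zero_le_one
  rw [hausdorffMeasure_real, hs, mul_zero] at h
  exact le_antisymm h zero_le

theorem volume_image_eq_zero_of_hasDerivAt_zero {f : ℝ → ℝ} {s : Set ℝ}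
    (hf : ∀ x ∈ s, HasDerivAt f 0 x) : volume (f '' s) = 0 := by
  refine addHaar_image_eq_zero_of_det_fderivWithin_eq_zero (f' := fun _ => 0) volume
    (fun x hx => ?_) (fun x _ => ?_)
  · have := (hf x hx).hasFDerivAt.hasFDerivWithinAt (s := s)
    rwa [ContinuousLinearMap.toSpanSingleton_zero] at this
  · simp [ContinuousLinearMap.det]

/-- Over a common denominator of size at least `ε ^ 2`, the numerator varies at rate at most `C +
M`. -/
theorem lipschitzOnWith_div_sin {G : ℝ → ℝ} {C : NNReal} {M : ℝ} (hG : LipschitzWith C G)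
    (hM : ∀ θ, |G θ| ≤ M) (p : ℝ) {ε : ℝ} (hε : 0 < ε) :
    LipschitzOnWith (Real.toNNReal ((C + M) / ε ^ 2)) (fun θ => -G θ / Real.sin (θ - p))
      {θ | ε ≤ |Real.sin (θ - p)|} := by
  have hM0 : 0 ≤ M := (abs_nonneg _).trans (hM 0)
  refine LipschitzOnWith.of_dist_le_mul fun x hx y hy => ?_
  rw [Real.coe_toNNReal _ (by positivity)]
  simp only [mem_ofPred_eq] at hx hy
  have hx0 : Real.sin (x - p) ≠ 0 := abs_pos.1 (hε.trans_le hx)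
  have hy0 : Real.sin (y - p) ≠ 0 := abs_pos.1 (hε.trans_le hy)
  have hGxy : |G y - G x| ≤ C * |x - y| := by
    have := hG.dist_le_mul x y
    rwa [dist_comm, Real.dist_eq, Real.dist_eq] at this
  have hsxy : |Real.sin (x - p) - Real.sin (y - p)| ≤ |x - y| := by
    have := Real.abs_sin_sub_sin_le (x - p) (y - p)
    simpa using this
  rw [Real.dist_eq, Real.dist_eq]
  have hE : -G x / Real.sin (x - p) - -G y / Real.sin (y - p) =
      ((G y - G x) * Real.sin (x - p) + G x * (Real.sin (x - p) - Real.sin (y - p))) /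
        (Real.sin (x - p) * Real.sin (y - p)) := by
    field_simp
    ring
  rw [hE, abs_div, abs_mul (Real.sin (x - p)), div_mul_eq_mul_div]
  refine div_le_div₀ (by positivity) ?_ (by positivity) ?_
  · calc _ ≤ |G y - G x| * |Real.sin (x - p)| + |G x| * |Real.sin (x - p) - Real.sin (y - p)| := by
          rw [← abs_mul, ← abs_mul]; exact abs_add_le _ _
      _ ≤ C * |x - y| * 1 + M * |x - y| := by
          gcongr
          · exact Real.abs_sin_le_one _
          · exact hM x
      _ = _ := by ring
  · rw [pow_two]
    gcongr

/-- For almost every `t`, the zeros of `G + t sin (· - p)` are transversal and avoid a given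
null set. -/
theorem ae_forall_zero_transversal {G : ℝ → ℝ} {C : NNReal} {M : ℝ} (hG : LipschitzWith C G)
    (hM : ∀ θ, |G θ| ≤ M) {D : Set ℝ} (hD : ∀ θ ∈ D, DifferentiableAt ℝ G θ)
    (hN : volume Dᶜ = 0) {p : ℝ} (hp : ∀ k : ℤ, p + k * Real.pi ∈ D) :
    ∀ᵐ t : ℝ, ∀ θ, G θ + t * Real.sin (θ - p) = 0 →
      θ ∈ D ∧ deriv G θ + t * Real.cos (θ - p) ≠ 0 := by
  -- Where the sine is nonzero, zeros for the parameter `t` are solutions of `f θ = t`, and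
  -- degenerate ones are critical points of `f`. So `t` must avoid three null sets: the values of
  -- `f` off `D`, its critical values, and countably many values from the zeros of the sine.
  set f : ℝ → ℝ := fun θ => -G θ / Real.sin (θ - p) with hf
  have h1 : ∀ n : ℕ, volume (f '' ({θ | 1 / ((n : ℝ) + 1) ≤ |Real.sin (θ - p)|} ∩ Dᶜ)) = 0 :=
    fun n => volume_image_eq_zero_of_lipschitzOnWith
      ((lipschitzOnWith_div_sin hG hM p Nat.one_div_pos_of_nat).mono inter_subset_left)
      (measure_mono_null inter_subset_right hN)
  have h2 : volume (f '' {θ | HasDerivAt f 0 θ}) = 0 :=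
    volume_image_eq_zero_of_hasDerivAt_zero fun x hx => hx
  have h3 : volume (range fun k : ℤ =>
      -deriv G (p + k * Real.pi) / Real.cos (k * Real.pi)) = 0 :=
    (countable_range _).measure_zero _
  have h1' := measure_iUnion_null h1
  filter_upwards [compl_mem_ae_iff.2 h1', compl_mem_ae_iff.2 h2, compl_mem_ae_iff.2 h3]
    with t ht1 ht2 ht3 θ hθ
  by_cases hs : Real.sin (θ - p) = 0
  · obtain ⟨k, hk⟩ := Real.sin_eq_zero_iff.1 hs
    have hθk : θ = p + k * Real.pi := by linarith
    refine ⟨hθk ▸ hp k, fun h => ht3 ⟨k, ?_⟩⟩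
    have hc : Real.cos (k * Real.pi) ≠ 0 := by
      rw [hk]
      intro hc
      have := Real.sin_sq_add_cos_sq (θ - p)
      rw [hs, hc] at this
      norm_num at this
    rw [← hk, hθk] at h
    simp only
    rw [div_eq_iff hc]
    linarith
  · have hft : f θ = t := by
      rw [hf]
      simp only
      rw [div_eq_iff hs]
      linarith
    have hθD : θ ∈ D := by
      by_contra hθD
      refine ht1 ?_
      obtain ⟨n, hn⟩ := exists_nat_one_div_lt (abs_pos.2 hs)
      exact mem_iUnion.2 ⟨n, θ, ⟨hn.le, hθD⟩, hft⟩
    refine ⟨hθD, fun h => ht2 ⟨θ, ?_, hft⟩⟩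
    have hs' : HasDerivAt (fun θ => Real.sin (θ - p)) (Real.cos (θ - p)) θ := by
      simpa using ((hasDerivAt_id θ).sub_const p).sin
    have := ((hD θ hθD).hasDerivAt.neg).div hs' hs
    refine this.congr_deriv ?_
    rw [div_eq_zero_iff]
    left
    simp only [Pi.neg_apply]
    linear_combination (-Real.sin (θ - p)) * h + Real.cos (θ - p) * hθ

/-- A continuous function that decreases from a positive to a negative value has a zero in between
at which its derivative, if nonzero, is negative. -/
theorem exists_zero_deriv_neg {F F' : ℝ → ℝ} (hc : Continuous F) {x y : ℝ} (hxy : x < y)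
    (hx : 0 < F x) (hy : F y < 0)
    (hF : ∀ z, F z = 0 → HasDerivAt F (F' z) z ∧ F' z ≠ 0) :
    ∃ z ∈ Ioo x y, F z = 0 ∧ F' z < 0 := by
  -- The wanted zero is the last point of the interval where `F` is nonnegative; the slopes to its
  -- right are nonpositive.
  set S := Icc x y ∩ F ⁻¹' Ici 0 with hS
  have hScomp : IsCompact S := isCompact_Icc.inter_right (isClosed_Ici.preimage hc)
  have hSne : S.Nonempty := ⟨x, ⟨le_rfl, hxy.le⟩, hx.le⟩
  obtain ⟨z, hzS, hz⟩ := hScomp.exists_isGreatest hSne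
  have hzy : z < y := by
    refine lt_of_le_of_ne hzS.1.2 ?_
    rintro rfl
    exact absurd hzS.2 (not_le.2 hy)
  have hneg : ∀ w ∈ Ioc z y, F w < 0 := by
    intro w hw
    by_contra h
    exact absurd (hz ⟨⟨hzS.1.1.trans hw.1.le, hw.2⟩, not_lt.1 h⟩) (not_le.2 hw.1)
  have hz0 : F z = 0 := by
    refine le_antisymm ?_ hzS.2
    refine le_of_tendsto (hc.continuousAt.continuousWithinAt (s := Ioi z) (x := z)) ?_
    filter_upwards [Ioc_mem_nhdsGT hzy] with w hw using (hneg w hw).le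
  have hxz : x < z := by
    refine lt_of_le_of_ne hzS.1.1 ?_
    rintro rfl
    exact hx.ne' hz0
  refine ⟨z, ⟨hxz, hzy⟩, hz0, lt_of_le_of_ne ?_ (hF z hz0).2⟩
  have := (hF z hz0).1.hasDerivWithinAt (s := Ioi z)
  rw [hasDerivWithinAt_iff_tendsto_slope' (by simp)] at this
  refine le_of_tendsto this ?_
  filter_upwards [Ioc_mem_nhdsGT hzy] with w hw
  rw [slope_def_field, hz0, sub_zero]
  exact div_nonpos_of_nonpos_of_nonneg (hneg w hw).le (by linarith [hw.1])

/-! ### Sign changes of functions orthogonal to trigonometric polynomials of degree one -/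

/-- With only two sign changes, some `cos (θ - m) - l` would change sign at the same places; its
product with `g` would have one sign, against orthogonality. -/
theorem exists_four_sign_changes {g : ℝ → ℝ} (hc : Continuous g)
    (hper : Function.Periodic g (2 * Real.pi)) (hne : g ≠ 0)
    (h0 : ∫ θ in (0)..(2 * Real.pi), g θ = 0)
    (hcos : ∫ θ in (0)..(2 * Real.pi), g θ * Real.cos θ = 0)
    (hsin : ∫ θ in (0)..(2 * Real.pi), g θ * Real.sin θ = 0) :
    ∃ θ₁ θ₂ θ₃ θ₄ : ℝ, θ₁ < θ₂ ∧ θ₂ < θ₃ ∧ θ₃ < θ₄ ∧ θ₄ < θ₁ + 2 * Real.pi ∧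
      0 < g θ₁ ∧ g θ₂ < 0 ∧ 0 < g θ₃ ∧ g θ₄ < 0 := by
  have hpi := Real.pi_pos
  have key : ∀ a m l : ℝ,
      ∫ θ in a..(a + 2 * Real.pi), g θ * (Real.cos (θ - m) - l) = 0 := by
    intro a m l
    have hp : Function.Periodic (fun θ => g θ * (Real.cos (θ - m) - l)) (2 * Real.pi) := by
      intro θ
      simp only
      rw [hper θ, show θ + 2 * Real.pi - m = θ - m + 2 * Real.pi by ring, Real.cos_add_two_pi]
    rw [hp.intervalIntegral_add_eq a 0, zero_add]
    have : ∀ θ, g θ * (Real.cos (θ - m) - l) = Real.cos m * (g θ * Real.cos θ) +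
        Real.sin m * (g θ * Real.sin θ) - l * g θ := by
      intro θ
      rw [Real.cos_sub]
      ring
    simp_rw [this]
    rw [intervalIntegral.integral_sub, intervalIntegral.integral_add,
      intervalIntegral.integral_const_mul, intervalIntegral.integral_const_mul,
      intervalIntegral.integral_const_mul, h0, hcos, hsin]
    · ring
    all_goals exact Continuous.intervalIntegrable (by fun_prop) _ _
  obtain ⟨a, ha⟩ : ∃ a, g a < 0 := by
    by_contra! h
    obtain ⟨b, hb⟩ := Function.ne_iff.1 hne
    have hb : 0 < g b := lt_of_le_of_ne (h b) (Ne.symm hb)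
    have hpos : 0 < ∫ θ in b..(b + 2 * Real.pi), g θ :=
      intervalIntegral.integral_pos (by linarith) hc.continuousOn (fun x _ => h x)
        ⟨b, ⟨le_rfl, by linarith⟩, hb⟩
    rw [hper.intervalIntegral_add_eq b 0, zero_add, h0] at hpos
    exact hpos.false
  have ha' : g (a + 2 * Real.pi) < 0 := by rwa [hper a]
  -- The period starts at a negative value, so the positive set lies strictly inside it.
  set P := {θ | θ ∈ Icc a (a + 2 * Real.pi) ∧ 0 < g θ} with hP
  have hPne : P.Nonempty := by
    by_contra h
    rw [not_nonempty_iff_eq_empty] at h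
    have hle : ∀ x ∈ Icc a (a + 2 * Real.pi), g x ≤ 0 := by
      intro x hx
      by_contra hx'
      have : x ∈ P := ⟨hx, not_le.1 hx'⟩
      rw [h] at this
      exact this
    have hpos : 0 < ∫ θ in a..(a + 2 * Real.pi), -g θ :=
      intervalIntegral.integral_pos (by linarith) hc.neg.continuousOn
        (fun x hx => neg_nonneg.2 (hle x ⟨hx.1.le, hx.2⟩))
        ⟨a, ⟨le_rfl, by linarith⟩, neg_pos.2 ha⟩
    rw [intervalIntegral.integral_neg, hper.intervalIntegral_add_eq a 0, zero_add, h0] at hpos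
    simp at hpos
  have hbdd : BddBelow P := ⟨a, fun x hx => hx.1.1⟩
  have hbdd' : BddAbove P := ⟨a + 2 * Real.pi, fun x hx => hx.1.2⟩
  obtain ⟨x₀, hx₀⟩ := hPne
  set p := sInf P with hp
  set q := sSup P with hq
  have hpq : p ≤ q := (csInf_le hbdd hx₀).trans (le_csSup hbdd' hx₀)
  have hap : a < p := by
    have hev : ∀ᶠ x in 𝓝 a, g x < 0 := hc.continuousAt.eventually_lt continuousAt_const ha
    obtain ⟨ε, hε, hball⟩ := Metric.eventually_nhds_iff.1 hev
    refine (lt_add_of_pos_right a hε).trans_le (le_csInf ⟨x₀, hx₀⟩ fun x hx => ?_)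
    by_contra! hlt
    refine absurd (hball (y := x) ?_) (not_lt.2 hx.2.le)
    rw [Real.dist_eq, abs_lt]
    constructor <;> linarith [hx.1.1]
  have hqa : q ≤ a + 2 * Real.pi := csSup_le ⟨x₀, hx₀⟩ fun x hx => hx.1.2
  by_cases hmid : ∃ θ ∈ Ioo p q, g θ < 0
  · obtain ⟨θ, ⟨hpθ, hθq⟩, hgθ⟩ := hmid
    obtain ⟨θ₁, hθ₁, h1⟩ := exists_lt_of_csInf_lt ⟨x₀, hx₀⟩ hpθ
    obtain ⟨θ₃, hθ₃, h3⟩ := exists_lt_of_lt_csSup ⟨x₀, hx₀⟩ hθq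
    refine ⟨θ₁, θ, θ₃, a + 2 * Real.pi, h1, h3, ?_, ?_, hθ₁.2, hgθ, hθ₃.2, ha'⟩
    · refine lt_of_le_of_ne hθ₃.1.2 ?_
      rintro rfl
      exact absurd hθ₃.2 (not_lt.2 ha'.le)
    · have : a < θ₁ := hap.trans_le (csInf_le hbdd hθ₁)
      linarith
  · exfalso
    push Not at hmid
    -- This weight vanishes at `p` and `q`, is positive between them and negative on the rest of the
    -- period.
    have hprod : ∀ θ, Real.cos (θ - (p + q) / 2) - Real.cos ((q - p) / 2) =
        -2 * Real.sin ((θ - p) / 2) * Real.sin ((θ - q) / 2) := by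
      intro θ
      rw [Real.cos_sub_cos]
      ring_nf
    have hnn : ∀ θ ∈ Icc a (a + 2 * Real.pi),
        0 ≤ g θ * (Real.cos (θ - (p + q) / 2) - Real.cos ((q - p) / 2)) := by
      intro θ hθ
      rw [hprod]
      rcases lt_or_ge θ p with h | h
      · have hg : g θ ≤ 0 := by
          by_contra hg
          exact absurd (csInf_le hbdd (show θ ∈ P from ⟨hθ, not_le.1 hg⟩)) (not_le.2 h)
        have s1 : Real.sin ((θ - p) / 2) ≤ 0 :=
          Real.sin_nonpos_of_nonpos_of_neg_pi_le (by linarith) (by linarith [hθ.1])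
        have s2 : Real.sin ((θ - q) / 2) ≤ 0 :=
          Real.sin_nonpos_of_nonpos_of_neg_pi_le (by linarith) (by linarith [hθ.1])
        nlinarith [mul_nonneg_of_nonpos_of_nonpos s1 s2]
      rcases lt_or_ge q θ with h' | h'
      · have hg : g θ ≤ 0 := by
          by_contra hg
          exact absurd (le_csSup hbdd' (show θ ∈ P from ⟨hθ, not_le.1 hg⟩)) (not_le.2 h')
        have s1 : 0 ≤ Real.sin ((θ - p) / 2) :=
          Real.sin_nonneg_of_nonneg_of_le_pi (by linarith) (by linarith [hθ.2])
        have s2 : 0 ≤ Real.sin ((θ - q) / 2) :=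
          Real.sin_nonneg_of_nonneg_of_le_pi (by linarith) (by linarith [hθ.2])
        nlinarith [mul_nonneg s1 s2]
      · rcases eq_or_lt_of_le h with rfl | h
        · simp
        rcases eq_or_lt_of_le h' with rfl | h'
        · simp
        have hg := hmid θ ⟨h, h'⟩
        have s1 : 0 ≤ Real.sin ((θ - p) / 2) :=
          Real.sin_nonneg_of_nonneg_of_le_pi (by linarith) (by linarith [hθ.2])
        have s2 : Real.sin ((θ - q) / 2) ≤ 0 :=
          Real.sin_nonpos_of_nonpos_of_neg_pi_le (by linarith) (by linarith [hθ.1])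
        nlinarith [mul_nonneg s1 (neg_nonneg.2 s2)]
    have hpa : p ≤ a + 2 * Real.pi := hpq.trans hqa
    have hqlt : q < a + 2 * Real.pi := by
      have hev : ∀ᶠ x in 𝓝 (a + 2 * Real.pi), g x < 0 :=
        hc.continuousAt.eventually_lt continuousAt_const ha'
      obtain ⟨ε, hε, hball⟩ := Metric.eventually_nhds_iff.1 hev
      refine (csSup_le ⟨x₀, hx₀⟩ fun x hx => ?_).trans_lt (sub_lt_self (a + 2 * Real.pi) hε)
      by_contra! hlt
      refine absurd (hball (y := x) ?_) (not_lt.2 hx.2.le)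
      rw [Real.dist_eq, abs_lt]
      constructor <;> linarith [hx.1.2]
    have hpos := intervalIntegral.integral_pos (a := a) (b := a + 2 * Real.pi)
      (f := fun θ => g θ * (Real.cos (θ - (p + q) / 2) - Real.cos ((q - p) / 2)))
      (by linarith) (by fun_prop) (fun x hx => hnn x ⟨hx.1.le, hx.2⟩)
      ⟨a, ⟨le_rfl, by linarith⟩, by
        rw [hprod]
        have s1 : Real.sin ((a - p) / 2) < 0 :=
          Real.sin_neg_of_neg_of_neg_pi_lt (by linarith) (by linarith)
        have s2 : Real.sin ((a - q) / 2) < 0 :=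
          Real.sin_neg_of_neg_of_neg_pi_lt (by linarith) (by linarith)
        nlinarith [mul_pos_of_neg_of_neg s1 s2]⟩
    rw [key] at hpos
    exact hpos.false

/-! ### Directions, rotations and the support function -/

theorem inner_eq (u x : Plane) : inner ℝ u x = u 0 * x 0 + u 1 * x 1 := by
  simp [PiLp.inner_apply, Fin.sum_univ_two, mul_comm]

theorem norm_sq_eq (x : Plane) : ‖x‖ ^ 2 = x 0 ^ 2 + x 1 ^ 2 := by
  simp [EuclideanSpace.norm_sq_eq, Fin.sum_univ_two]

theorem det_sub (u x y : Plane) : det u (x - y) = det u x - det u y := by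
  simp only [det, PiLp.sub_apply]
  ring

theorem det_sq_add_inner_sq (u x : Plane) :
    det u x ^ 2 + (inner ℝ u x : ℝ) ^ 2 = ‖u‖ ^ 2 * ‖x‖ ^ 2 := by
  rw [norm_sq_eq, norm_sq_eq, inner_eq, det]
  ring

theorem abs_det_le (u x : Plane) : |det u x| ≤ ‖u‖ * ‖x‖ := by
  refine abs_le_of_sq_le_sq ?_ (by positivity)
  nlinarith [det_sq_add_inner_sq u x, sq_nonneg (inner ℝ u x : ℝ)]

@[fun_prop]
theorem continuous_det (u : Plane) : Continuous (det u) := by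
  unfold det
  fun_prop

/-- The unit vector of polar angle `θ`. -/
noncomputable def dirVec (θ : ℝ) : Plane := !₂[Real.cos θ, Real.sin θ]

@[simp] theorem dirVec_zero (θ : ℝ) : dirVec θ 0 = Real.cos θ := rfl

@[simp] theorem dirVec_one (θ : ℝ) : dirVec θ 1 = Real.sin θ := rfl

theorem norm_dirVec (θ : ℝ) : ‖dirVec θ‖ = 1 := by
  rw [← sq_eq_sq₀ (norm_nonneg _) zero_le_one, norm_sq_eq]
  simp

theorem det_dirVec (θ : ℝ) (x : Plane) :
    det (dirVec θ) x = Real.cos θ * x 1 - Real.sin θ * x 0 := rfl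

theorem exists_eq_norm_mul_dirVec (w : Plane) :
    ∃ θ, w 0 = ‖w‖ * Real.cos θ ∧ w 1 = ‖w‖ * Real.sin θ := by
  have hw : ‖(⟨w 0, w 1⟩ : ℂ)‖ = ‖w‖ := by
    rw [← sq_eq_sq₀ (norm_nonneg _) (norm_nonneg _), norm_sq_eq, Complex.sq_norm,
      Complex.normSq_apply]
    ring
  refine ⟨Complex.arg ⟨w 0, w 1⟩, ?_, ?_⟩
  · rw [← hw, Complex.norm_mul_cos_arg]
  · rw [← hw, Complex.norm_mul_sin_arg]

theorem dirVec_ne_of_lt {θ θ' : ℝ} (h : θ < θ') (h' : θ' < θ + 2 * Real.pi) :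
    dirVec θ ≠ dirVec θ' := by
  intro he
  have hc : Real.cos θ = Real.cos θ' := congrArg (fun x : Plane => x 0) he
  have hs : Real.sin θ = Real.sin θ' := congrArg (fun x : Plane => x 1) he
  have h1 : Real.cos (θ' - θ) = 1 := by
    rw [Real.cos_sub, hc, hs]
    nlinarith [Real.sin_sq_add_cos_sq θ']
  have := (Real.cos_eq_one_iff_of_lt_of_lt (by linarith [Real.pi_pos]) (by linarith)).1 h1
  linarith

/-- The rotation by the angle `α` about the origin, followed by the translation by `c`. -/
noncomputable def rotTrans (α : ℝ) (c : Plane) : Plane ≃ᵢ Plane :=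
  IsometryEquiv.mk'
    (fun x => !₂[Real.cos α * x 0 - Real.sin α * x 1 + c 0,
      Real.sin α * x 0 + Real.cos α * x 1 + c 1])
    (fun y => !₂[Real.cos α * (y 0 - c 0) + Real.sin α * (y 1 - c 1),
      -Real.sin α * (y 0 - c 0) + Real.cos α * (y 1 - c 1)])
    (fun y => by
      ext i
      fin_cases i
      · simp
        linear_combination (y 0 - c 0) * Real.sin_sq_add_cos_sq α
      · simp
        linear_combination (y 1 - c 1) * Real.sin_sq_add_cos_sq α)
    (Isometry.of_dist_eq fun x y => by
      rw [EuclideanSpace.dist_eq, EuclideanSpace.dist_eq]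
      congr 1
      simp only [Fin.sum_univ_two, Real.dist_eq, sq_abs]
      simp
      linear_combination ((x 0 - y 0) ^ 2 + (x 1 - y 1) ^ 2) * Real.sin_sq_add_cos_sq α)

theorem det_dirVec_rotTrans (θ α : ℝ) (c x : Plane) :
    det (dirVec θ) (rotTrans α c x) = det (dirVec (θ - α)) x + det (dirVec θ) c := by
  simp only [det_dirVec, rotTrans, IsometryEquiv.mk', Real.cos_sub, Real.sin_sub]
  simp
  ring

/-- The signed distance from the origin of the supporting line of `K` of direction `θ`. -/
noncomputable def suppFun (K : Set Plane) (θ : ℝ) : ℝ := sInf (det (dirVec θ) '' K)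

section

variable {K : Set Plane}

theorem exists_det_eq_suppFun (hne : K.Nonempty) (hK : IsCompact K) (θ : ℝ) :
    ∃ x ∈ K, det (dirVec θ) x = suppFun K θ :=
  (hK.image (continuous_det _)).sInf_mem (hne.image _)

theorem suppFun_le (hK : IsCompact K) (θ : ℝ) {x : Plane} (hx : x ∈ K) :
    suppFun K θ ≤ det (dirVec θ) x :=
  csInf_le (hK.image (continuous_det _)).bddBelow (mem_image_of_mem _ hx)

theorem suppFun_add_two_pi (K : Set Plane) : Function.Periodic (suppFun K) (2 * Real.pi) := by
  intro θ
  have : dirVec (θ + 2 * Real.pi) = dirVec θ := by simp [dirVec]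
  rw [suppFun, this, suppFun]

theorem suppFun_image_rotTrans (hne : K.Nonempty) (hK : IsCompact K) (α : ℝ) (c : Plane) (θ : ℝ) :
    suppFun (rotTrans α c '' K) θ = suppFun K (θ - α) + det (dirVec θ) c := by
  have hK' : IsCompact (rotTrans α c '' K) := hK.image (rotTrans α c).continuous
  apply le_antisymm
  · obtain ⟨x, hx, he⟩ := exists_det_eq_suppFun hne hK (θ - α)
    rw [← he, ← det_dirVec_rotTrans]
    exact suppFun_le hK' θ (mem_image_of_mem _ hx)
  · obtain ⟨_, ⟨x, hx, rfl⟩, he⟩ := exists_det_eq_suppFun (hne.image (rotTrans α c)) hK' θ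
    rw [← he, det_dirVec_rotTrans]
    gcongr
    exact suppFun_le hK _ hx

/-- The functions `det (dirVec ·) x` are uniformly Lipschitz for `x` in a bounded set, and their
infimum inherits the constant. Rademacher's theorem then gives differentiability almost everywhere.
-/
theorem exists_lipschitzWith_suppFun (hne : K.Nonempty) (hK : IsCompact K) :
    ∃ C, LipschitzWith C (suppFun K) := by
  obtain ⟨R, hR⟩ := hK.isBounded.exists_norm_le
  have hR0 : 0 ≤ R := by
    obtain ⟨x, hx⟩ := hne
    exact (norm_nonneg x).trans (hR x hx)
  refine ⟨Real.toNNReal (2 * R), LipschitzWith.of_le_add_mul _ fun s t => ?_⟩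
  rw [Real.coe_toNNReal _ (by positivity)]
  obtain ⟨x, hx, he⟩ := exists_det_eq_suppFun hne hK t
  have h1 := suppFun_le hK s hx
  have hx0 : |x 0| ≤ R := (PiLp.norm_apply_le x 0).trans (hR x hx)
  have hx1 : |x 1| ≤ R := (PiLp.norm_apply_le x 1).trans (hR x hx)
  have hc : |Real.cos s - Real.cos t| ≤ dist s t := by
    simpa [Real.dist_eq] using Real.abs_cos_sub_cos_le s t
  have hs : |Real.sin s - Real.sin t| ≤ dist s t := by
    simpa [Real.dist_eq] using Real.abs_sin_sub_sin_le s t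
  have h2 : det (dirVec s) x - det (dirVec t) x ≤ 2 * R * dist s t := by
    calc _ = (Real.cos s - Real.cos t) * x 1 - (Real.sin s - Real.sin t) * x 0 := by
          simp only [det_dirVec]; ring
      _ ≤ |Real.cos s - Real.cos t| * |x 1| + |Real.sin s - Real.sin t| * |x 0| := by
          rw [← abs_mul, ← abs_mul]
          exact (le_abs_self _).trans (abs_sub _ _)
      _ ≤ dist s t * R + dist s t * R := by gcongr
      _ = _ := by ring
  linarith

theorem hasDerivAt_det_dirVec (x : Plane) (θ : ℝ) :
    HasDerivAt (fun t => det (dirVec t) x) (-inner ℝ (dirVec θ) x) θ := by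
  have := ((Real.hasDerivAt_cos θ).mul_const (x 1)).sub ((Real.hasDerivAt_sin θ).mul_const (x 0))
  refine this.congr_deriv ?_
  rw [inner_eq]
  simp
  ring

/-- Where the support function is differentiable, its derivative locates the unique point of `K` on
the supporting line. -/
theorem inner_eq_neg_of_hasDerivAt (hK : IsCompact K) {θ h' : ℝ}
    (hd : HasDerivAt (suppFun K) h' θ) {x : Plane} (hx : x ∈ K)
    (he : det (dirVec θ) x = suppFun K θ) : inner ℝ (dirVec θ) x = -h' := by
  -- This difference is nonnegative and vanishes at the contact direction.
  have hmin : IsLocalMin (fun t => det (dirVec t) x - suppFun K t) θ := by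
    refine Eventually.of_forall fun t => ?_
    simp only
    rw [he, sub_self]
    linarith [suppFun_le hK t hx]
  have := hmin.hasDerivAt_eq_zero ((hasDerivAt_det_dirVec x θ).sub hd)
  linarith

/-- The supporting line of `K` of direction `θ`. -/
noncomputable def suppLine (K : Set Plane) (θ : ℝ) : DirectedLine :=
  ⟨dirVec θ, norm_dirVec θ, suppFun K θ⟩

/-- Along the line, every contact point of `K` has coordinate `-h` and every one of `K'` has
coordinate `-h'`, so `h' < h` puts `K` behind `K'`. -/
theorem leadsFromTo_suppLine {K' : Set Plane} (hne : K.Nonempty) (hK : IsCompact K)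
    (hne' : K'.Nonempty) (hK' : IsCompact K') {θ h h' : ℝ} (hd : HasDerivAt (suppFun K) h θ)
    (hd' : HasDerivAt (suppFun K') h' θ) (heq : suppFun K' θ = suppFun K θ) (hlt : h' < h) :
    LeadsFromTo K K' (suppLine K θ) := by
  obtain ⟨x, hx, hxe⟩ := exists_det_eq_suppFun hne hK θ
  obtain ⟨x', hx', hxe'⟩ := exists_det_eq_suppFun hne' hK' θ
  have key : ∀ y ∈ K, det (dirVec θ) y = suppFun K θ → inner ℝ (dirVec θ) y = -h :=
    fun y hy he => inner_eq_neg_of_hasDerivAt hK hd hy he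
  have key' : ∀ y ∈ K', det (dirVec θ) y = suppFun K θ → inner ℝ (dirVec θ) y = -h' :=
    fun y hy he => inner_eq_neg_of_hasDerivAt hK' hd' hy (he.trans heq.symm)
  rw [heq] at hxe'
  have hix := key x hx hxe
  have hix' := key' x' hx' hxe'
  refine ⟨⟨⟨x, hxe, hx⟩, fun y hy => suppFun_le hK θ hy⟩,
    ⟨⟨x', hxe', hx'⟩, fun y hy => heq.symm.trans_le (suppFun_le hK' θ hy)⟩,
    ⟨x, ⟨⟨Or.inl hx, hxe⟩, ?_⟩, hx, fun hmem => ?_⟩,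
    ⟨x', ⟨⟨Or.inr hx', hxe'⟩, ?_⟩, hx', fun hmem => ?_⟩⟩
  · rintro y ⟨hy | hy, hye⟩
    · exact (hix.trans (key y hy hye).symm).le
    · refine (hix.trans_le ?_).trans_eq (key' y hy hye).symm
      linarith
  · linarith [key' x hmem hxe]
  · rintro y ⟨hy | hy, hye⟩
    · refine ((key y hy hye).trans_le ?_).trans_eq hix'.symm
      linarith
    · exact ((key' y hy hye).trans hix'.symm).le
  · linarith [key x' hmem hxe']

/-- A compact convex set whose support function is that of a closed ball is a disk. -/
theorem isDisk_of_suppFun_eq (hne : K.Nonempty) (hK : IsCompact K) (hconv : Convex ℝ K)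
    {c : Plane} {r : ℝ} (h : ∀ θ, suppFun K θ = det (dirVec θ) c - r) : IsDisk K := by
  -- Opposite directions bound the width: `2 * r` is at least 0.
  have hr : 0 ≤ r := by
    obtain ⟨x, hx⟩ := hne
    have h0 := suppFun_le hK 0 hx
    have h1 := suppFun_le hK Real.pi hx
    rw [h] at h0 h1
    simp [det_dirVec] at h0 h1
    linarith
  refine ⟨Metric.sphere c r, ⟨c, r, hr, rfl⟩, ?_⟩
  rw [convexHull_sphere_eq_closedBall c hr]
  ext x
  rw [mem_closedBall_iff_norm]
  constructor
  · intro hx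
    obtain ⟨θ, h0, h1⟩ := exists_eq_norm_mul_dirVec (x - c)
    -- The direction is a quarter turn from `x - c`, so that `x` lies at distance `‖x - c‖` to the
    -- right of the line through `c`.
    have hle := suppFun_le hK (θ + Real.pi / 2) hx
    have hle' : det (dirVec (θ + Real.pi / 2)) (x - c) = -‖x - c‖ := by
      rw [det_dirVec, h0, h1, Real.cos_add_pi_div_two, Real.sin_add_pi_div_two]
      linear_combination -‖x - c‖ * Real.sin_sq_add_cos_sq θ
    rw [h] at hle
    rw [det_sub] at hle'
    linarith
  · intro hx
    by_contra hxK
    obtain ⟨f, u, hfx, hfK⟩ := geometric_hahn_banach_point_closed hconv hK.isClosed hxK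
    obtain ⟨w, rfl⟩ := (InnerProductSpace.toDual ℝ Plane).surjective f
    simp only [InnerProductSpace.toDual_apply_apply] at hfx hfK
    obtain ⟨θ, h0, h1⟩ := exists_eq_norm_mul_dirVec w
    -- A quarter turn converts the separating functional into a multiple of `det`, comparable with
    -- the support function.
    have hdet : ∀ y : Plane, inner ℝ w y = ‖w‖ * det (dirVec (θ - Real.pi / 2)) y := by
      intro y
      rw [inner_eq, det_dirVec, Real.cos_sub_pi_div_two, Real.sin_sub_pi_div_two, h0, h1]
      ring
    obtain ⟨y, hy, hye⟩ := exists_det_eq_suppFun hne hK (θ - Real.pi / 2)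
    have hlt := hfx.trans (hfK y hy)
    rw [hdet, hdet, hye, h] at hlt
    have hlt' := lt_of_mul_lt_mul_left hlt (norm_nonneg w)
    have habs := abs_det_le (dirVec (θ - Real.pi / 2)) (x - c)
    rw [norm_dirVec, one_mul, det_sub] at habs
    linarith [(abs_le.1 (habs.trans hx)).1]

end

/-! ### Disks do not cross their isometric copies -/

theorem isClosedBall_of_isDisk {D : Set Plane} (hD : IsDisk D) :
    ∃ (c : Plane) (r : ℝ), 0 ≤ r ∧ D = Metric.closedBall c r := by
  obtain ⟨_, ⟨c, r, hr, rfl⟩, rfl⟩ := hD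
  exact ⟨c, r, hr, convexHull_sphere_eq_closedBall c hr⟩

theorem IsSupportingLine.offset_eq_of_closedBall {c : Plane} {r : ℝ} (hr : 0 ≤ r) {t : DirectedLine}
    (ht : IsSupportingLine (Metric.closedBall c r) t) : t.offset = det t.dir c - r := by
  obtain ⟨⟨x, hxt, hx⟩, hsub⟩ := ht
  rw [mem_closedBall_iff_norm] at hx
  have hu : t.dir 0 ^ 2 + t.dir 1 ^ 2 = 1 := by rw [← norm_sq_eq, t.norm_dir, one_pow]
  apply le_antisymm
  -- The centre moved by `r` along the right normal is the extreme point of the ball.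
  · have hmem : c - r • !₂[-t.dir 1, t.dir 0] ∈ Metric.closedBall c r := by
      rw [mem_closedBall_iff_norm, sub_sub_cancel_left, norm_neg, norm_smul, Real.norm_of_nonneg hr]
      refine mul_le_of_le_one_right hr ?_
      rw [← sq_le_sq₀ (norm_nonneg _) zero_le_one, norm_sq_eq]
      simp
      linarith
    have := hsub hmem
    simp only [DirectedLine.leftHalfplane, mem_ofPred_eq, det_sub] at this
    have he : det t.dir (r • !₂[-t.dir 1, t.dir 0]) = r := by
      simp [det]
      linear_combination r * hu
    linarith
  · have := abs_det_le t.dir (x - c)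
    rw [t.norm_dir, one_mul, det_sub] at this
    have hxt' : det t.dir x = t.offset := hxt
    linarith [(abs_le.1 (this.trans hx)).1]

/-- The component of `x - c` normal to the line already has length `r`, leaving no room for a
tangential one. -/
theorem IsSupportingLine.inner_eq_of_closedBall {c : Plane} {r : ℝ} (hr : 0 ≤ r) {t : DirectedLine}
    (ht : IsSupportingLine (Metric.closedBall c r) t) {x : Plane} (hx : x ∈ Metric.closedBall c r)
    (hxt : x ∈ t.points) : inner ℝ t.dir x = (inner ℝ t.dir c : ℝ) := by
  have ho := ht.offset_eq_of_closedBall hr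
  rw [mem_closedBall_iff_norm] at hx
  have hxt' : det t.dir x = t.offset := hxt
  have hsq := det_sq_add_inner_sq t.dir (x - c)
  rw [det_sub, hxt', ho, t.norm_dir, inner_sub_right] at hsq
  have : ‖x - c‖ ^ 2 ≤ r ^ 2 := by gcongr
  have h0 : ((inner ℝ t.dir x : ℝ) - inner ℝ t.dir c) ^ 2 ≤ 0 := by nlinarith
  have := pow_eq_zero_iff (two_ne_zero) |>.1 (le_antisymm h0 (sq_nonneg _))
  linarith

/-- Equal radii force the line to be parallel to `c' - c`; the order of the contact points fixes its
orientation, and tangency its offset. -/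
theorem LeadsFromTo.eq_of_closedBall {c c' : Plane} {r : ℝ} (hr : 0 ≤ r) {t₁ t₂ : DirectedLine}
    (h₁ : LeadsFromTo (Metric.closedBall c r) (Metric.closedBall c' r) t₁)
    (h₂ : LeadsFromTo (Metric.closedBall c r) (Metric.closedBall c' r) t₂) : t₁ = t₂ := by
  have key : ∀ t, LeadsFromTo (Metric.closedBall c r) (Metric.closedBall c' r) t →
      ‖c' - c‖ • t.dir = c' - c := by
    rintro t ⟨hs, hs', ⟨U, hU, hUK, hUK'⟩, ⟨U', hU', hUK'', hUK'''⟩⟩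
    have hi := hs.inner_eq_of_closedBall hr hUK hU.1.2
    have hi' := hs'.inner_eq_of_closedBall hr hUK'' hU'.1.2
    have hle := hU.2 U' hU'.1
    rw [hi, hi'] at hle
    have hd : det t.dir (c' - c) = 0 := by
      rw [det_sub]
      linarith [hs.offset_eq_of_closedBall hr, hs'.offset_eq_of_closedBall hr]
    have hsq := det_sq_add_inner_sq t.dir (c' - c)
    rw [hd, t.norm_dir] at hsq
    have hin : (inner ℝ t.dir (c' - c) : ℝ) = ‖c' - c‖ := by
      rw [← sq_eq_sq₀ (by rw [inner_sub_right]; linarith) (norm_nonneg _)]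
      linarith
    rw [← hin, inner_eq]
    have hu : t.dir 0 ^ 2 + t.dir 1 ^ 2 = 1 := by rw [← norm_sq_eq, t.norm_dir, one_pow]
    unfold det at hd
    ext i
    fin_cases i
    · simp only [Fin.zero_eta, PiLp.smul_apply, smul_eq_mul]
      linear_combination (c' - c).ofLp 0 * hu + t.dir 1 * hd
    · simp only [Fin.mk_one, PiLp.smul_apply, smul_eq_mul]
      linear_combination (c' - c).ofLp 1 * hu - t.dir 0 * hd
  have hcc : c' - c ≠ 0 := by
    intro h
    obtain ⟨_, _, ⟨U, _, hUK, hUK'⟩, _⟩ := h₁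
    rw [sub_eq_zero.1 h] at hUK'
    exact hUK' hUK
  have hdir : t₁.dir = t₂.dir :=
    smul_right_injective _ (norm_ne_zero_iff.2 hcc) ((key t₁ h₁).trans (key t₂ h₂).symm)
  refine DirectedLine.ext hdir ?_
  rw [h₁.1.offset_eq_of_closedBall hr, h₂.1.offset_eq_of_closedBall hr, hdir]

theorem IsDisk.not_crossEachOther {K₀ K₁ : Set Plane} (hK : IsDisk K₀) (h : IsIsometricTo K₁ K₀) :
    ¬ CrossEachOther K₀ K₁ := by
  obtain ⟨c, r, hr, rfl⟩ := isClosedBall_of_isDisk hK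
  obtain ⟨φ, rfl⟩ := h
  rw [φ.image_closedBall]
  rintro (⟨t₁, t₂, hne, h₁, h₂⟩ | ⟨t₁, t₂, hne, h₁, h₂⟩)
  · exact hne (h₁.eq_of_closedBall hr h₂)
  · exact hne (h₁.eq_of_closedBall hr h₂)

/-! ### Compact convex sets other than disks cross an isometric copy -/

theorem exists_abs_suppFun_le {K : Set Plane} (hne : K.Nonempty) (hK : IsCompact K) :
    ∃ R, ∀ θ, |suppFun K θ| ≤ R := by
  obtain ⟨R, hR⟩ := hK.isBounded.exists_norm_le
  refine ⟨R, fun θ => ?_⟩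
  obtain ⟨x, hx, he⟩ := exists_det_eq_suppFun hne hK θ
  rw [← he]
  have := abs_det_le (dirVec θ) x
  rw [norm_dirVec, one_mul] at this
  exact this.trans (hR x hx)

/-- At the zeros of `sin (θ - p)` the perturbation cannot move a zero away, so `p` is chosen to put
these points in the differentiability set. -/
theorem ae_forall_add_int_mul_pi_mem {D : Set ℝ} (hD : volume Dᶜ = 0) :
    ∀ᵐ p : ℝ, ∀ k : ℤ, p + k * Real.pi ∈ D := by
  rw [ae_all_iff]
  intro k
  have := (measurePreserving_add_right volume ((k : ℝ) * Real.pi)).quasiMeasurePreserving.ae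
    (p := fun x => x ∈ D) (mem_ae_iff.2 hD)
  exact this

/-- If the difference of the support functions of `K` and of a rotated copy changes sign four times
in a period, then some translate of that copy crosses `K`. -/
theorem exists_crossEachOther_of_sign_changes {K : Set Plane} (hne : K.Nonempty) (hK : IsCompact K)
    {α : ℝ} {c : Plane} {g : ℝ → ℝ}
    (hg : ∀ θ, g θ = suppFun (rotTrans α c '' K) θ - suppFun K θ) {θ₁ θ₂ θ₃ θ₄ : ℝ}
    (h12 : θ₁ < θ₂) (h23 : θ₂ < θ₃) (h34 : θ₃ < θ₄) (h41 : θ₄ < θ₁ + 2 * Real.pi)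
    (h1 : 0 < g θ₁) (h2 : g θ₂ < 0) (h3 : 0 < g θ₃) (h4 : g θ₄ < 0) :
    ∃ c' : Plane, CrossEachOther K (rotTrans α c' '' K) := by
  have hne' := hne.image (rotTrans α c)
  have hK' : IsCompact (rotTrans α c '' K) := hK.image (rotTrans α c).continuous
  obtain ⟨C, hC⟩ := exists_lipschitzWith_suppFun hne hK
  obtain ⟨C', hC'⟩ := exists_lipschitzWith_suppFun hne' hK'
  obtain ⟨R, hR⟩ := exists_abs_suppFun_le hne hK
  obtain ⟨R', hR'⟩ := exists_abs_suppFun_le hne' hK'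
  set D := {θ | DifferentiableAt ℝ (suppFun K) θ ∧
    DifferentiableAt ℝ (suppFun (rotTrans α c '' K)) θ} with hDdef
  have hD0 : volume Dᶜ = 0 :=
    compl_mem_ae_iff.1 (by
      filter_upwards [hC.ae_differentiableAt (μ := volume), hC'.ae_differentiableAt (μ := volume)]
        with θ h h'
      rw [compl_compl]
      exact ⟨h, h'⟩)
  have hg' : g = fun θ => suppFun (rotTrans α c '' K) θ - suppFun K θ := funext hg
  have hgL : LipschitzWith (C' + C) g := hg' ▸ hC'.sub hC
  have hgM : ∀ θ, |g θ| ≤ R' + R := fun θ => by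
    rw [hg]
    exact (abs_sub _ _).trans (add_le_add (hR' θ) (hR θ))
  have hgD : ∀ θ ∈ D, HasDerivAt g
      (deriv (suppFun (rotTrans α c '' K)) θ - deriv (suppFun K) θ) θ := fun θ hθ => by
    rw [hg']
    exact hθ.2.hasDerivAt.sub hθ.1.hasDerivAt
  obtain ⟨p, hp⟩ := (ae_forall_add_int_mul_pi_mem hD0).exists
  have hae := ae_forall_zero_transversal hgL hgM (fun θ hθ => (hgD θ hθ).differentiableAt) hD0 hp
  -- A perturbation of size below `ε` preserves all four signs.
  set ε := min (min (g θ₁) (-g θ₂)) (min (g θ₃) (-g θ₄)) with hε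
  have hεpos : 0 < ε := lt_min (lt_min h1 (neg_pos.2 h2)) (lt_min h3 (neg_pos.2 h4))
  obtain ⟨t, ⟨ht0, htε⟩, ht⟩ : ∃ t ∈ Ioo 0 ε, ∀ θ, g θ + t * Real.sin (θ - p) = 0 →
      θ ∈ D ∧ deriv g θ + t * Real.cos (θ - p) ≠ 0 := by
    by_contra! hcon
    have hsub : Ioo 0 ε ⊆ {t | ¬ ∀ θ, g θ + t * Real.sin (θ - p) = 0 →
        θ ∈ D ∧ deriv g θ + t * Real.cos (θ - p) ≠ 0} := by
      intro t ht h
      obtain ⟨θ, hθ, hn⟩ := hcon t ht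
      exact (h θ hθ).2 (hn (h θ hθ).1)
    have := measure_mono_null hsub (ae_iff.1 hae)
    rw [Real.volume_Ioo, ENNReal.ofReal_eq_zero] at this
    linarith
  obtain ⟨⟨e1, e2⟩, e3, e4⟩ : (t < g θ₁ ∧ t < -g θ₂) ∧ t < g θ₃ ∧ t < -g θ₄ := by
    simpa only [hε, lt_min_iff] using htε
  have hsmall : ∀ θ, |t * Real.sin (θ - p)| ≤ t := fun θ => by
    rw [abs_mul, abs_of_pos ht0]
    exact mul_le_of_le_one_right ht0.le (Real.abs_sin_le_one _)
  set F : ℝ → ℝ := fun θ => g θ + t * Real.sin (θ - p) with hF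
  have hFc : Continuous F := by
    have := hgL.continuous
    fun_prop
  have hFd : ∀ θ, F θ = 0 → HasDerivAt F (deriv g θ + t * Real.cos (θ - p)) θ ∧
      deriv g θ + t * Real.cos (θ - p) ≠ 0 := fun θ hθ => by
    obtain ⟨hθD, hθn⟩ := ht θ hθ
    refine ⟨?_, hθn⟩
    have hs : HasDerivAt (fun θ => Real.sin (θ - p)) (Real.cos (θ - p)) θ := by
      simpa using ((hasDerivAt_id θ).sub_const p).sin
    exact (hgD θ hθD).differentiableAt.hasDerivAt.add (hs.const_mul t)
  obtain ⟨z, hz, hz0, hzn⟩ := exists_zero_deriv_neg hFc h12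
    (by linarith [(abs_le.1 (hsmall θ₁)).1]) (by linarith [(abs_le.1 (hsmall θ₂)).2]) hFd
  obtain ⟨w, hw, hw0, hwn⟩ := exists_zero_deriv_neg hFc h34
    (by linarith [(abs_le.1 (hsmall θ₃)).1]) (by linarith [(abs_le.1 (hsmall θ₄)).2]) hFd
  -- Since `det (dirVec θ) (dirVec p) = -sin (θ - p)`, this shift adds exactly `t * sin (θ - p)`.
  set c' : Plane := c - t • dirVec p with hc'
  have hsupp : ∀ θ, suppFun (rotTrans α c' '' K) θ = suppFun K θ + F θ := by
    intro θ
    simp only [hF]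
    rw [hg, suppFun_image_rotTrans hne hK, suppFun_image_rotTrans hne hK, hc', det_sub,
      Real.sin_sub]
    simp only [det_dirVec, PiLp.smul_apply, smul_eq_mul, dirVec_zero, dirVec_one]
    ring
  have hleads : ∀ z, F z = 0 → deriv g z + t * Real.cos (z - p) < 0 →
      LeadsFromTo K (rotTrans α c' '' K) (suppLine K z) := by
    intro z hz hn
    have hd := (ht z hz).1.1.hasDerivAt
    refine leadsFromTo_suppLine (h := deriv (suppFun K) z)
      (h' := deriv (suppFun K) z + (deriv g z + t * Real.cos (z - p))) hne hK (hne.image _)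
      (hK.image (rotTrans α c').continuous) hd ?_ ?_ ?_
    · rw [funext hsupp]
      exact hd.add (hFd z hz).1
    · rw [hsupp, hz, add_zero]
    · linarith
  refine ⟨c', Or.inl ⟨suppLine K z, suppLine K w, fun h => ?_, hleads z hz0 hzn, hleads w hw0 hwn⟩⟩
  exact dirVec_ne_of_lt (by linarith [hz.2, hw.1]) (by linarith [hz.1, hw.2])
    (congrArg DirectedLine.dir h)

theorem exists_crossEachOther {K : Set Plane} (hne : K.Nonempty) (hK : IsCompact K)
    (hround : ¬ ∃ (c : Plane) (r : ℝ), ∀ θ, suppFun K θ = det (dirVec θ) c - r) :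
    ∃ (α : ℝ) (c : Plane), CrossEachOther K (rotTrans α c '' K) := by
  have hpi := Real.pi_pos
  obtain ⟨C, hC⟩ := exists_lipschitzWith_suppFun hne hK
  have hhc : Continuous (suppFun K) := hC.continuous
  -- First Fourier coefficients: the subtracted harmonic is `det (dirVec θ)` of the point `(-B, A)`.
  set A := (∫ θ in (0)..(2 * Real.pi), suppFun K θ * Real.cos θ) / Real.pi with hA
  set B := (∫ θ in (0)..(2 * Real.pi), suppFun K θ * Real.sin θ) / Real.pi with hB
  set k : ℝ → ℝ := fun θ => suppFun K θ - (A * Real.cos θ + B * Real.sin θ) with hk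
  have hkc : Continuous k := by fun_prop
  have hkper : Function.Periodic k (2 * Real.pi) := fun θ => by
    simp only [hk, suppFun_add_two_pi K θ, Real.cos_add_two_pi, Real.sin_add_two_pi]
  have hkcos : ∫ θ in (0)..(2 * Real.pi), k θ * Real.cos θ = 0 := by
    have : ∀ θ, k θ * Real.cos θ = suppFun K θ * Real.cos θ - A * Real.cos θ ^ 2 -
        B * (Real.sin θ * Real.cos θ) := fun θ => by simp only [hk]; ring
    simp_rw [this]
    rw [intervalIntegral.integral_sub, intervalIntegral.integral_sub,
      intervalIntegral.integral_const_mul, intervalIntegral.integral_const_mul, integral_cos_sq,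
      integral_sin_mul_cos₁, hA]
    · simp
    all_goals exact Continuous.intervalIntegrable (by fun_prop) _ _
  have hksin : ∫ θ in (0)..(2 * Real.pi), k θ * Real.sin θ = 0 := by
    have : ∀ θ, k θ * Real.sin θ = suppFun K θ * Real.sin θ - B * Real.sin θ ^ 2 -
        A * (Real.sin θ * Real.cos θ) := fun θ => by simp only [hk]; ring
    simp_rw [this]
    rw [intervalIntegral.integral_sub, intervalIntegral.integral_sub,
      intervalIntegral.integral_const_mul, intervalIntegral.integral_const_mul, integral_sin_sq,
      integral_sin_mul_cos₁, hB]
    · simp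
    all_goals exact Continuous.intervalIntegrable (by fun_prop) _ _
  have hshift : ∀ (f : ℝ → ℝ) (α : ℝ), Function.Periodic f (2 * Real.pi) →
      ∫ θ in (0)..(2 * Real.pi), f (θ - α) = ∫ θ in (0)..(2 * Real.pi), f θ := by
    intro f α hf
    rw [intervalIntegral.integral_comp_sub_right, show 2 * Real.pi - α = 0 - α + 2 * Real.pi by ring,
      hf.intervalIntegral_add_eq (0 - α) 0, zero_add]
  have hkcos_per : Function.Periodic (fun θ => k θ * Real.cos θ) (2 * Real.pi) :=
    hkper.mul Real.cos_periodic
  have hksin_per : Function.Periodic (fun θ => k θ * Real.sin θ) (2 * Real.pi) :=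
    hkper.mul Real.sin_periodic
  obtain ⟨α, hα⟩ : ∃ α, (fun θ => k (θ - α) - k θ) ≠ 0 := by
    by_contra! hcon
    -- Invariance of `k` under all shifts makes it constant, giving the support function of a ball
    -- about `(-B, A)`.
    refine hround ⟨!₂[-B, A], -k 0, fun θ => ?_⟩
    have := congrFun (hcon θ) θ
    simp only [sub_self, Pi.zero_apply] at this
    rw [sub_eq_zero.1 this]
    simp [det_dirVec, hk]
    ring
  have hcosα : ∫ θ in (0)..(2 * Real.pi), k (θ - α) * Real.cos θ = 0 := by
    have : ∀ θ, k (θ - α) * Real.cos θ = Real.cos α * (k (θ - α) * Real.cos (θ - α)) -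
        Real.sin α * (k (θ - α) * Real.sin (θ - α)) := fun θ => by
      have : Real.cos θ = Real.cos (θ - α + α) := by rw [sub_add_cancel]
      rw [this, Real.cos_add]
      ring
    simp_rw [this]
    rw [intervalIntegral.integral_sub, intervalIntegral.integral_const_mul,
      intervalIntegral.integral_const_mul, hshift _ α hkcos_per, hshift _ α hksin_per, hkcos, hksin]
    · ring
    all_goals exact Continuous.intervalIntegrable (by fun_prop) _ _
  have hsinα : ∫ θ in (0)..(2 * Real.pi), k (θ - α) * Real.sin θ = 0 := by
    have : ∀ θ, k (θ - α) * Real.sin θ = Real.cos α * (k (θ - α) * Real.sin (θ - α)) +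
        Real.sin α * (k (θ - α) * Real.cos (θ - α)) := fun θ => by
      have : Real.sin θ = Real.sin (θ - α + α) := by rw [sub_add_cancel]
      rw [this, Real.sin_add]
      ring
    simp_rw [this]
    rw [intervalIntegral.integral_add, intervalIntegral.integral_const_mul,
      intervalIntegral.integral_const_mul, hshift _ α hkcos_per, hshift _ α hksin_per, hkcos, hksin]
    · ring
    all_goals exact Continuous.intervalIntegrable (by fun_prop) _ _
  obtain ⟨θ₁, θ₂, θ₃, θ₄, h12, h23, h34, h41, h1, h2, h3, h4⟩ :=
    exists_four_sign_changes (g := fun θ => k (θ - α) - k θ) (by fun_prop)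
      ((hkper.sub_const α).sub hkper) hα
      (by
        rw [intervalIntegral.integral_sub, hshift k α hkper, sub_self]
        all_goals exact Continuous.intervalIntegrable (by fun_prop) _ _)
      (by
        simp_rw [sub_mul]
        rw [intervalIntegral.integral_sub, hcosα, hkcos, sub_self]
        all_goals exact Continuous.intervalIntegrable (by fun_prop) _ _)
      (by
        simp_rw [sub_mul]
        rw [intervalIntegral.integral_sub, hsinα, hksin, sub_self]
        all_goals exact Continuous.intervalIntegrable (by fun_prop) _ _)
  refine ⟨α, exists_crossEachOther_of_sign_changes hne hK (g := fun θ => k (θ - α) - k θ)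
    -- This is `(-B, A)` minus its image under the rotation by `α`, so the motion is the rotation
    -- about `(-B, A)`.
    (c := !₂[-(B - A * Real.sin α - B * Real.cos α), A - A * Real.cos α + B * Real.sin α])
    (fun θ => ?_) h12 h23 h34 h41 h1 h2 h3 h4⟩
  rw [suppFun_image_rotTrans hne hK]
  simp [hk, det_dirVec, Real.cos_sub, Real.sin_sub]
  ring

end PlaneCrossing

theorem lemma4 (K₀ : Set PlaneCrossing.Plane) (hne : K₀.Nonempty) (hcompact : IsCompact K₀)
    (hconvex : Convex ℝ K₀) :
    PlaneCrossing.IsDisk K₀ ↔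
      ∀ K₁ : Set PlaneCrossing.Plane, PlaneCrossing.IsIsometricTo K₁ K₀ →
        ¬ PlaneCrossing.CrossEachOther K₀ K₁ := by
  refine ⟨fun h K₁ hK₁ => h.not_crossEachOther hK₁, fun h => ?_⟩
  by_contra hdisk
  obtain ⟨α, c, hcross⟩ := PlaneCrossing.exists_crossEachOther hne hcompact
    fun ⟨_, _, hcr⟩ => hdisk (PlaneCrossing.isDisk_of_suppFun_eq hne hcompact hconvex hcr)
  exact h _ ⟨PlaneCrossing.rotTrans α c, rfl⟩ hcross
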